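/- Consider the untyped $\lambda$-calculus, with terms taken up to $\alpha$-equivalence. Let $\Lambda_A$ be the set of affine terms, defined inductively: every variable is in $\Lambda_A$; if $M \in \Lambda_A$ and $x$ has at most one free occurrence in $M$, then $\lambda x.M \in \Lambda_A$; if $M, N \in \Lambda_A$, then $MN \in \Lambda_A$. A finite $\beta$-reduction sequence $\sigma : M = M_0 \to_{R_1} M_1 \to_{R_2} \cdots \to_{R_n} M_n = N$ (where $R_i$ is the redex occurrence of $M_{i-1}$ contracted in step $i$) has length $|\sigma| = n$. Residuals: let $R = (\lambda x.P)Q$ be the redex occurrence contracted in a step $M \to_R M'$, and let $S$ be a redex occurrence of $M$. If $S$ is $R$, it has no residual in $M'$. If $S$ is inside $P$, its only residual is the corresponding redex $S\{Q/x\}$ in $P\{Q/x\}$. If $S$ is inside $Q$, its residuals are its copies in $P\{Q/x\}$, one for each free occurrence of $x$ in $P$. If $S$ properly contains $R$ or is disjoint from it, its only residual is the redex at the same position. Residuals along several steps are obtained by composing the one-step relations. A redex occurrence is to the left of another one if it begins further to the left in the written term. The sequence $\sigma$ is standard if for all $1 \le i < j \le n$ the redex $R_j$ is not a residual, along steps $i,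 \dots, j-1$, of a redex of $M_{i-1}$ to the left of $R_i$. Theorem (standardization without length increase in $\lambda A$). Let $M \in \Lambda_A$ and let $\sigma : M \twoheadrightarrow N$ be a finite $\beta$-reduction sequence. Then there is a standard $\beta$-reduction sequence $\sigma_s : M \twoheadrightarrow N$ with $|\sigma_s| \le |\sigma|$. -/

import Mathlib

/-- Untyped `λ`-terms up to `α`-equivalence, in de Bruijn notation: `var n` refers to the `n`-th
enclosing abstraction, counted from `0`, and to a free variable if there are not that many. -/
inductive Term : Type where
  | var (n : ℕ) : Term
  | app (M N : Term) : Term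
  | lam (M : Term) : Term

/-- A position in a term, as the path from the root: `0` goes to the function part of an
application or to the body of an abstraction, `1` goes to the argument of an application. -/
abbrev Pos : Type := List ℕ

namespace Term

/-- Action of a renaming under a binder. -/
def upRen (ξ : ℕ → ℕ) : ℕ → ℕ
  | 0 => 0
  | n + 1 => ξ n + 1

/-- Simultaneous (capture-avoiding) renaming of the free variables. -/
def rename : (ℕ → ℕ) → Term → Term
  | ξ, var n => var (ξ n)
  | ξ, app M N => app (rename ξ M) (rename ξ N)
  | ξ, lam M => lam (rename (upRen ξ) M)

/-- Action of a substitution under a binder. -/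
def up (s : ℕ → Term) : ℕ → Term
  | 0 => var 0
  | n + 1 => rename Nat.succ (s n)

/-- Simultaneous capture-avoiding substitution for the free variables. -/
def subst : (ℕ → Term) → Term → Term
  | s, var n => s n
  | s, app M N => app (subst s M) (subst s N)
  | s, lam M => lam (subst (up s) M)

/-- The substitution that replaces variable `0` by `Q` and lowers the other variables by one. -/
def single (Q : Term) : ℕ → Term
  | 0 => Q
  | n + 1 => var n

/-- `contractum P Q` is `P{Q/x}`, the contractum of the redex `(λx.P) Q`. -/
def contractum (P Q : Term) : Term := subst (single Q) P

/-- `OccursAt k M o`: there is a free occurrence of the variable `k` in `M` at position `o`. -/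
inductive OccursAt : ℕ → Term → Pos → Prop
  | var (k : ℕ) : OccursAt k (var k) []
  | appFun {k : ℕ} {M N : Term} {o : Pos} : OccursAt k M o → OccursAt k (app M N) (0 :: o)
  | appArg {k : ℕ} {M N : Term} {o : Pos} : OccursAt k N o → OccursAt k (app M N) (1 :: o)
  | lam {k : ℕ} {M : Term} {o : Pos} : OccursAt (k + 1) M o → OccursAt k (lam M) (0 :: o)

/-- The terms of the affine calculus `λA`: in every subterm `λx.M`, the variable `x` has at most
one free occurrence in `M`. -/
inductive Affine : Term → Prop
  | var (n : ℕ) : Affine (var n)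
  | lam {M : Term} : Affine M → {o : Pos | OccursAt 0 M o}.Subsingleton → Affine (lam M)
  | app {M N : Term} : Affine M → Affine N → Affine (app M N)

/-- The subterm of a term at a position, if the position exists. -/
def subtermAt : Term → Pos → Option Term
  | M, [] => some M
  | app M _, 0 :: p => subtermAt M p
  | app _ N, 1 :: p => subtermAt N p
  | lam M, 0 :: p => subtermAt M p
  | _, _ => none

/-- There is a `β`-redex in `M` at position `p`. -/
def IsRedexAt (M : Term) (p : Pos) : Prop :=
  ∃ P Q : Term, M.subtermAt p = some (app (lam P) Q)

/-- `Step p M N`: contracting the `β`-redex at position `p` of `M` gives `N`, that is,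
`M = C[(λx.P) Q]` and `N = C[P{Q/x}]` for a one-hole context `C` with its hole at position `p`. -/
inductive Step : Pos → Term → Term → Prop
  | beta (P Q : Term) : Step [] (app (lam P) Q) (contractum P Q)
  | appFun {p : Pos} {M M' N : Term} : Step p M M' → Step (0 :: p) (app M N) (app M' N)
  | appArg {p : Pos} {M N N' : Term} : Step p N N' → Step (1 :: p) (app M N) (app M N')
  | lam {p : Pos} {M M' : Term} : Step p M M' → Step (0 :: p) (lam M) (lam M')

/-- The redex at `q` lies to the left of the redex at `p`: it begins further to the left in the
written term. Since a redex `(λx.P) Q` begins with its own `λ`, this says that the redex at `q`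
properly contains the one at `p` or is disjoint from it and comes first, which is the
(strict) lexicographic order of positions. -/
def LeftOf (q p : Pos) : Prop := q < p

/-- `Residual M p q r`: after the contraction of the redex `(λx.P) Q` at position `p` of `M`, the
redex at position `r` of the result is a residual of the redex at position `q` of `M`.
The redex at `p` itself has no residuals. -/
inductive Residual (M : Term) (p : Pos) : Pos → Pos → Prop
  /-- A redex inside `P` has one residual, in `P{Q/x}`. -/
  | inBody {P Q : Term} {s : Pos} : M.subtermAt p = some (app (lam P) Q) →
      M.IsRedexAt (p ++ 0 :: 0 :: s) → Residual M p (p ++ 0 :: 0 :: s) (p ++ s)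
  /-- A redex inside `Q` has as residuals all its copies, one per free occurrence of `x` in `P`. -/
  | inArg {P Q : Term} {s o : Pos} : M.subtermAt p = some (app (lam P) Q) →
      M.IsRedexAt (p ++ 1 :: s) → OccursAt 0 P o → Residual M p (p ++ 1 :: s) (p ++ o ++ s)
  /-- A redex that properly contains the contracted one, or is disjoint from it, stays in place. -/
  | outside {q : Pos} : M.IsRedexAt p → M.IsRedexAt q → ¬ p <+: q → Residual M p q q

/-- Finite `β`-reduction sequences from `M` to `N`, recording the redex contracted in each step. -/
inductive RedSeq : Term → Term → Type
  | nil (M : Term) : RedSeq M M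
  | cons {M M' N : Term} (p : Pos) (h : Step p M M') (σ : RedSeq M' N) : RedSeq M N

namespace RedSeq

/-- The length `|σ|`, the number of steps. -/
def length : {M N : Term} → RedSeq M N → ℕ
  | _, _, nil _ => 0
  | _, _, cons _ _ σ => σ.length + 1

/-- `ContractsResidual σ q`, for a redex at position `q` of the first term of `σ`: some step of `σ`
contracts that redex or a residual of it (along the preceding steps of `σ`). -/
def ContractsResidual : {M N : Term} → RedSeq M N → Pos → Prop
  | _, _, nil _, _ => False
  | M, _, cons p _ σ, q => q = p ∨ ∃ r : Pos, Residual M p q r ∧ σ.ContractsResidual r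

/-- A reduction sequence contracting `R₁, R₂, …, Rₙ` is standard if for all `i < j` the redex `Rⱼ`
is not a residual of a redex to the left of `Rᵢ` (in the term in which `Rᵢ` is contracted).
The first conjunct below is this condition for `i = 1` and all `j > 1`. -/
def IsStandard : {M N : Term} → RedSeq M N → Prop
  | _, _, nil _ => True
  | M, _, cons p _ σ =>
      (∀ q r : Pos, M.IsRedexAt q → LeftOf q p → Residual M p q r → ¬ σ.ContractsResidual r) ∧
        σ.IsStandard

end RedSeq

end Term

/-!
Every `β`-reduction `M ↠ N` can be rearranged into *weak head steps followed by reductions inside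
the immediate subterms*. The relation `StdRed n M N` describes the sequences of this shape by
recursion on their structure, with `n` counting the steps. Two facts give the theorem.

* `StdRed.exists_isStandard`: a derivation of `StdRed n M N` can be read as a standard reduction
  sequence of length `n`. No redex is to the left of a weak head redex, so a leading head step
  imposes no condition. In an application, the function part is reduced before the argument; the
  residuals of a redex in one part stay in this part, and the root redex, if there is one, is not
  contracted any more.
* `StdRed.trans_step`: if `M` is affine, appending one arbitrary step to `StdRed n M N` gives
  `StdRed m M K` with `m ≤ n + 1`. The essential case is a root redex `(λx.P') N'` reached from
  `M₁ N₁`, where `M₁` reaches some `λx.P` by head steps. The redex `(λx.P) N₁` is then contracted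
  as a head step, and it remains to go from `P{N₁/x}` to `P'{N'/x}`.

That last part is the substitution lemma `StdRed.subst`: the reduction of the substituted terms is
paid for once per occurrence of the variable. The cost is measured by `weight`, the weighted number
of free variable occurrences. Since `P` is affine, the reduction of `N₁` is paid for at most once,
and since weak head reduction of affine terms does not increase weights (`HeadStep.weight_le`), the
bound survives the head steps performed on the way.
-/

namespace Term

/-! ### Renaming and substitution -/

theorem upRen_comp (ξ ζ : ℕ → ℕ) : upRen (ξ ∘ ζ) = upRen ξ ∘ upRen ζ := by
  funext n; cases n <;> rfl

theorem rename_rename (ξ ζ : ℕ → ℕ) (M : Term) :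
    rename ξ (rename ζ M) = rename (ξ ∘ ζ) M := by
  induction M generalizing ξ ζ with
  | var n => rfl
  | app M N ihM ihN => simp [rename, ihM, ihN]
  | lam M ih => simp [rename, ih, upRen_comp]

theorem up_comp_upRen (s : ℕ → Term) (ξ : ℕ → ℕ) : up s ∘ upRen ξ = up (s ∘ ξ) := by
  funext n; cases n <;> rfl

theorem subst_rename (s : ℕ → Term) (ξ : ℕ → ℕ) (M : Term) :
    subst s (rename ξ M) = subst (s ∘ ξ) M := by
  induction M generalizing s ξ with
  | var n => rfl
  | app M N ihM ihN => simp [rename, subst, ihM, ihN]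
  | lam M ih => simp [rename, subst, ih, up_comp_upRen]

theorem rename_comp_up (ξ : ℕ → ℕ) (s : ℕ → Term) :
    rename (upRen ξ) ∘ up s = up (rename ξ ∘ s) := by
  funext n
  cases n with
  | zero => rfl
  | succ n =>
    simp only [Function.comp_apply, up, rename_rename]
    rfl

theorem rename_subst (ξ : ℕ → ℕ) (s : ℕ → Term) (M : Term) :
    rename ξ (subst s M) = subst (rename ξ ∘ s) M := by
  induction M generalizing s ξ with
  | var n => rfl
  | app M N ihM ihN => simp [rename, subst, ihM, ihN]
  | lam M ih => simp [rename, subst, ih, rename_comp_up]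

theorem subst_comp_up (s t : ℕ → Term) : subst (up s) ∘ up t = up (subst s ∘ t) := by
  funext n
  cases n with
  | zero => rfl
  | succ n =>
    simp only [Function.comp_apply, up, subst_rename, rename_subst]
    rfl

theorem subst_subst (s t : ℕ → Term) (M : Term) :
    subst s (subst t M) = subst (subst s ∘ t) M := by
  induction M generalizing s t with
  | var n => rfl
  | app M N ihM ihN => simp [subst, ihM, ihN]
  | lam M ih => simp [subst, ih, subst_comp_up]

theorem up_var : up var = var := by
  funext n; cases n <;> rfl

theorem subst_var (M : Term) : subst var M = M := by
  induction M with
  | var n => rfl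
  | app M N ihM ihN => simp [subst, ihM, ihN]
  | lam M ih => simp [subst, up_var, ih]

theorem rename_contractum (ξ : ℕ → ℕ) (P Q : Term) :
    rename ξ (contractum P Q) = contractum (rename (upRen ξ) P) (rename ξ Q) := by
  unfold contractum
  rw [rename_subst, subst_rename]
  congr 1
  funext n; cases n <;> rfl

theorem subst_contractum (s : ℕ → Term) (P Q : Term) :
    subst s (contractum P Q) = contractum (subst (up s) P) (subst s Q) := by
  unfold contractum
  rw [subst_subst, subst_subst]
  congr 1
  funext n
  cases n with
  | zero => rfl
  | succ n =>
    simp only [Function.comp_apply, single, up, subst, subst_rename]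
    exact (subst_var _).symm

/-! ### Weights and affine terms -/

/-- The family of weights `w` with `a` inserted as the weight of the variable `0`. -/
def consWeight (a : ℕ) (w : ℕ → ℕ) : ℕ → ℕ
  | 0 => a
  | n + 1 => w n

/-- The sum of `w n` over all free occurrences of variables `n` in a term. With `w = Pi.single k 1`
this is the number of free occurrences of `k`. -/
def weight : (ℕ → ℕ) → Term → ℕ
  | w, var n => w n
  | w, app M N => weight w M + weight w N
  | w, lam M => weight (consWeight 0 w) M

theorem weight_rename (w : ℕ → ℕ) (ξ : ℕ → ℕ) (M : Term) :
    weight w (rename ξ M) = weight (w ∘ ξ) M := by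
  induction M generalizing w ξ with
  | var n => rfl
  | app M N ihM ihN => simp [rename, weight, ihM, ihN]
  | lam M ih =>
    simp only [rename, weight, ih]
    congr 1
    funext n; cases n <;> rfl

theorem weight_subst (w : ℕ → ℕ) (s : ℕ → Term) (M : Term) :
    weight w (subst s M) = weight (fun n => weight w (s n)) M := by
  induction M generalizing w s with
  | var n => rfl
  | app M N ihM ihN => simp [subst, weight, ihM, ihN]
  | lam M ih =>
    simp only [subst, weight, ih]
    congr 1
    funext n
    cases n with
    | zero => rfl
    | succ n =>
      simp only [up, weight_rename]
      rfl

theorem weight_zero (M : Term) : weight 0 M = 0 := by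
  induction M with
  | var n => rfl
  | app M N ihM ihN => simp [weight, ihM, ihN]
  | lam M ih =>
    have h0 : consWeight 0 0 = 0 := by funext n; cases n <;> rfl
    rw [weight, h0, ih]

theorem weight_add_mul (v w : ℕ → ℕ) (a : ℕ) (M : Term) :
    weight (fun n => v n + a * w n) M = weight v M + a * weight w M := by
  induction M generalizing v w with
  | var n => rfl
  | app M N ihM ihN => simp only [weight, ihM, ihN]; ring
  | lam M ih =>
    simp only [weight, ← ih]
    congr 1
    funext n; cases n <;> simp [consWeight]

theorem weight_consWeight (a : ℕ) (w : ℕ → ℕ) (M : Term) :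
    weight (consWeight a w) M = weight w (lam M) + a * weight (Pi.single 0 1) M := by
  rw [weight, ← weight_add_mul]
  congr 1
  funext n; cases n <;> simp [consWeight]

theorem consWeight_zero_single (k : ℕ) :
    consWeight 0 (Pi.single k 1) = Pi.single (k + 1) 1 := by
  funext n
  cases n <;> simp [consWeight, Pi.single_apply]

theorem OccursAt.weight_pos {k : ℕ} {M : Term} {o : Pos} (h : OccursAt k M o) :
    0 < weight (Pi.single k 1) M := by
  induction h with
  | var k => simp [weight]
  | appFun _ ih => simp only [weight]; omega
  | appArg _ ih => simp only [weight]; omega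
  | lam _ ih => simpa only [weight, consWeight_zero_single] using ih

theorem exists_occursAt_of_weight_pos {k : ℕ} {M : Term} (h : 0 < weight (Pi.single k 1) M) :
    ∃ o, OccursAt k M o := by
  induction M generalizing k with
  | var n =>
    obtain rfl : n = k := by
      by_contra hne
      simp [weight, hne] at h
    exact ⟨[], .var n⟩
  | app M N ihM ihN =>
    rcases Nat.eq_zero_or_pos (weight (Pi.single k 1) M) with h0 | hpos
    · obtain ⟨o, ho⟩ := ihN (k := k) (by simp only [weight] at h; omega)
      exact ⟨_, .appArg ho⟩
    · obtain ⟨o, ho⟩ := ihM hpos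
      exact ⟨_, .appFun ho⟩
  | lam M ih =>
    rw [weight, consWeight_zero_single] at h
    obtain ⟨o, ho⟩ := ih h
    exact ⟨_, .lam ho⟩

theorem subsingleton_occursAt_iff {k : ℕ} {M : Term} :
    {o : Pos | OccursAt k M o}.Subsingleton ↔ weight (Pi.single k 1) M ≤ 1 := by
  constructor
  · intro h
    induction M generalizing k with
    | var n =>
      simp only [weight, Pi.single_apply]
      split <;> omega
    | app M N ihM ihN =>
      have hM := ihM (k := k) fun o ho o' ho' => by simpa using h (.appFun ho) (.appFun ho')
      have hN := ihN (k := k) fun o ho o' ho' => by simpa using h (.appArg ho) (.appArg ho')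
      by_contra hlt
      simp only [weight] at hlt
      obtain ⟨o, ho⟩ := exists_occursAt_of_weight_pos (k := k) (M := M) (by omega)
      obtain ⟨o', ho'⟩ := exists_occursAt_of_weight_pos (k := k) (M := N) (by omega)
      simpa using h (.appFun ho) (.appArg ho')
    | lam M ih =>
      rw [weight, consWeight_zero_single]
      exact ih fun o ho o' ho' => by simpa using h (.lam ho) (.lam ho')
  · intro h o ho o' ho'
    simp only [Set.mem_ofPred_eq] at ho ho'
    induction ho generalizing o' with
    | var k => cases ho'; rfl
    | appFun h1 ih =>
      simp only [weight] at h
      cases ho' with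
      | appFun h2 => rw [ih (by omega) h2]
      | appArg h2 =>
        have := h1.weight_pos
        have := h2.weight_pos
        omega
    | appArg h1 ih =>
      simp only [weight] at h
      cases ho' with
      | appFun h2 =>
        have := h1.weight_pos
        have := h2.weight_pos
        omega
      | appArg h2 => rw [ih (by omega) h2]
    | lam h1 ih =>
      rw [weight, consWeight_zero_single] at h
      cases ho' with
      | lam h2 => rw [ih h h2]

theorem affine_app_iff {M N : Term} : (app M N).Affine ↔ M.Affine ∧ N.Affine :=
  ⟨fun h => by cases h; constructor <;> assumption, fun h => .app h.1 h.2⟩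

theorem affine_lam_iff {M : Term} :
    (lam M).Affine ↔ M.Affine ∧ weight (Pi.single 0 1) M ≤ 1 := by
  rw [← subsingleton_occursAt_iff]
  exact ⟨fun h => by cases h; constructor <;> assumption, fun h => .lam h.1 h.2⟩

theorem Affine.rename {M : Term} (h : M.Affine) (ξ : ℕ → ℕ) : (M.rename ξ).Affine := by
  induction M generalizing ξ with
  | var n => exact .var _
  | app M N ihM ihN =>
    rw [affine_app_iff] at h
    exact .app (ihM h.1 ξ) (ihN h.2 ξ)
  | lam M ih =>
    rw [affine_lam_iff] at h
    refine affine_lam_iff.2 ⟨ih h.1 _, ?_⟩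
    rw [weight_rename]
    convert h.2 using 2
    funext n; cases n <;> simp [upRen]

theorem Affine.subst {M : Term} (h : M.Affine) {s : ℕ → Term} (hs : ∀ n, (s n).Affine) :
    (M.subst s).Affine := by
  induction M generalizing s with
  | var n => exact hs n
  | app M N ihM ihN =>
    rw [affine_app_iff] at h
    exact .app (ihM h.1 hs) (ihN h.2 hs)
  | lam M ih =>
    rw [affine_lam_iff] at h
    refine affine_lam_iff.2 ⟨ih h.1 ?_, ?_⟩
    · intro n
      cases n with
      | zero => exact .var 0
      | succ n => exact (hs n).rename _
    · -- the terms `up s (n + 1)` are shifted, so the bound variable occurs only in `up s 0`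
      rw [weight_subst]
      convert h.2 using 2
      funext n
      cases n with
      | zero => simp [up, weight]
      | succ n =>
        have h0 : (Pi.single 0 1 : ℕ → ℕ) ∘ Nat.succ = 0 := by funext i; simp
        rw [up, weight_rename, h0, weight_zero, Pi.single_eq_of_ne (by omega)]

theorem Affine.contractum {P Q : Term} (hP : P.Affine) (hQ : Q.Affine) :
    (contractum P Q).Affine :=
  hP.subst fun n => by
    cases n with
    | zero => exact hQ
    | succ n => exact .var n

/-! ### Weak head reduction -/

/-- A weak head step: the contracted redex is the function part at the end of the spine of
applications that starts at the root. -/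
inductive HeadStep : Term → Term → Prop
  | beta (P Q : Term) : HeadStep (app (lam P) Q) (contractum P Q)
  | appFun {M M' : Term} (N : Term) : HeadStep M M' → HeadStep (app M N) (app M' N)

theorem HeadStep.rename {M M' : Term} (h : HeadStep M M') (ξ : ℕ → ℕ) :
    HeadStep (M.rename ξ) (M'.rename ξ) := by
  induction h with
  | beta P Q =>
    rw [rename_contractum]
    exact .beta _ _
  | appFun N _ ih => exact .appFun _ ih

theorem HeadStep.subst {M M' : Term} (h : HeadStep M M') (s : ℕ → Term) :
    HeadStep (M.subst s) (M'.subst s) := by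
  induction h with
  | beta P Q =>
    rw [subst_contractum]
    exact .beta _ _
  | appFun N _ ih => exact .appFun _ ih

theorem HeadStep.affine {M M' : Term} (h : HeadStep M M') (hM : M.Affine) : M'.Affine := by
  induction h with
  | beta P Q =>
    rw [affine_app_iff, affine_lam_iff] at hM
    exact hM.1.1.contractum hM.2
  | appFun N _ ih =>
    rw [affine_app_iff] at hM
    exact .app (ih hM.1) hM.2

theorem weight_contractum (w : ℕ → ℕ) (P Q : Term) :
    weight w (contractum P Q) =
      weight w (lam P) + weight w Q * weight (Pi.single 0 1) P := by
  rw [contractum, weight_subst, ← weight_consWeight]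
  congr 1
  funext n; cases n <;> rfl

theorem HeadStep.weight_le {M M' : Term} (h : HeadStep M M') (hM : M.Affine) (w : ℕ → ℕ) :
    weight w M' ≤ weight w M := by
  induction h with
  | beta P Q =>
    rw [affine_app_iff, affine_lam_iff] at hM
    rw [weight_contractum, weight]
    have := Nat.mul_le_mul_left (weight w Q) hM.1.2
    omega
  | appFun N _ ih =>
    rw [affine_app_iff] at hM
    exact Nat.add_le_add_right (ih hM.1) _

/-- A weak head redex is the leftmost redex of its term. -/
theorem HeadStep.exists_step {M M' : Term} (h : HeadStep M M') :
    ∃ p, Step p M M' ∧ ∀ q, M.IsRedexAt q → ¬ LeftOf q p := by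
  induction h with
  | beta P Q => exact ⟨[], .beta P Q, fun q _ hq => List.not_lt_nil q hq⟩
  | @appFun M M' N h ih =>
    obtain ⟨p, hp, hl⟩ := ih
    refine ⟨0 :: p, .appFun hp, ?_⟩
    rintro (_ | ⟨_ | i, q⟩) hr hq
    · -- a weak head step is not possible in an abstraction
      obtain ⟨P, Q, he⟩ := hr
      simp only [subtermAt, Option.some.injEq, app.injEq] at he
      obtain ⟨rfl, -⟩ := he
      cases h
    · exact hl q hr (by simpa [LeftOf, List.cons_lt_cons_iff] using hq)
    · simp [LeftOf, List.cons_lt_cons_iff] at hq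

/-! ### Standard reduction by structural rules -/

/-- `StdRed n M N`: there is a reduction from `M` to `N` in `n` steps which consists of weak head
steps, followed by reductions of the same kind inside the immediate subterms, of which the function
part of an application is reduced before the argument. -/
inductive StdRed : ℕ → Term → Term → Prop
  | head {n : ℕ} {M M' N : Term} : HeadStep M M' → StdRed n M' N → StdRed (n + 1) M N
  | var (k : ℕ) : StdRed 0 (var k) (var k)
  | app {m n : ℕ} {M M' N N' : Term} :
      StdRed m M M' → StdRed n N N' → StdRed (m + n) (app M N) (app M' N')
  | lam {n : ℕ} {M M' : Term} : StdRed n M M' → StdRed n (lam M) (lam M')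

theorem StdRed.refl (M : Term) : StdRed 0 M M := by
  induction M with
  | var k => exact .var k
  | app M N ihM ihN => exact .app ihM ihN
  | lam M ih => exact .lam ih

theorem StdRed.rename {n : ℕ} {M N : Term} (h : StdRed n M N) (ξ : ℕ → ℕ) :
    StdRed n (M.rename ξ) (N.rename ξ) := by
  induction h generalizing ξ with
  | head h1 _ ih => exact .head (h1.rename ξ) (ih ξ)
  | var k => exact .var _
  | app _ _ ih1 ih2 => exact .app (ih1 ξ) (ih2 ξ)
  | lam _ ih => exact .lam (ih _)

/-- The reduction of the term substituted for a variable is carried out once for each free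
occurrence of this variable in `M`. -/
theorem StdRed.subst {n : ℕ} {M N : Term} (h : StdRed n M N) (hM : M.Affine) {w : ℕ → ℕ}
    {s t : ℕ → Term} (hst : ∀ k, StdRed (w k) (s k) (t k)) :
    ∃ m ≤ n + weight w M, StdRed m (M.subst s) (N.subst t) := by
  induction h generalizing w s t with
  | head h1 _ ih =>
    obtain ⟨m, hm, hr⟩ := ih (h1.affine hM) hst
    have := h1.weight_le hM w
    exact ⟨m + 1, by omega, .head (h1.subst s) hr⟩
  | var k => exact ⟨w k, by simp [weight], hst k⟩
  | app _ _ ih1 ih2 =>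
    rw [affine_app_iff] at hM
    obtain ⟨m1, hm1, hr1⟩ := ih1 hM.1 hst
    obtain ⟨m2, hm2, hr2⟩ := ih2 hM.2 hst
    exact ⟨m1 + m2, by simp only [weight]; omega, .app hr1 hr2⟩
  | lam _ ih =>
    rw [affine_lam_iff] at hM
    obtain ⟨m, hm, hr⟩ := ih hM.1 (w := consWeight 0 w) (s := up s) (t := up t) fun k => by
      cases k with
      | zero => exact .var 0
      | succ k => exact (hst k).rename _
    exact ⟨m, hm, .lam hr⟩

theorem StdRed.contractum {m n : ℕ} {P P' Q Q' : Term} (hP : StdRed m P P')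
    (hQ : StdRed n Q Q') (hA : (Term.lam P).Affine) :
    ∃ k ≤ m + n, StdRed k (contractum P Q) (contractum P' Q') := by
  rw [affine_lam_iff] at hA
  obtain ⟨k, hk, hr⟩ := hP.subst hA.1 (w := consWeight n 0) (s := single Q) (t := single Q')
    fun i => by
      cases i with
      | zero => exact hQ
      | succ i => exact .var i
  refine ⟨k, ?_, hr⟩
  rw [weight_consWeight, weight_zero] at hk
  have := Nat.mul_le_mul_left n hA.2
  omega

/-- A root redex in the target can be contracted earlier, as soon as head steps of the function
part `M` have produced an abstraction. -/
theorem StdRed.app_lam_contractum {m n : ℕ} {M P' N N' : Term} (h : StdRed m M (Term.lam P'))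
    (hN : StdRed n N N') (hM : M.Affine) :
    ∃ k ≤ m + n + 1, StdRed k (Term.app M N) (Term.contractum P' N') := by
  generalize hL : Term.lam P' = L at h
  induction h with
  | head h1 _ ih =>
    obtain ⟨k, hk, hr⟩ := ih (h1.affine hM) hL
    exact ⟨k + 1, by omega, .head (.appFun _ h1) hr⟩
  | var k => cases hL
  | app _ _ _ _ => cases hL
  | lam h1 _ =>
    cases hL
    obtain ⟨k, hk, hr⟩ := h1.contractum hN hM
    exact ⟨k + 1, by omega, .head (.beta _ _) hr⟩

theorem StdRed.trans_step {n : ℕ} {M N K : Term} {p : Pos} (h : StdRed n M N) (hM : M.Affine)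
    (hs : Step p N K) : ∃ m ≤ n + 1, StdRed m M K := by
  induction h generalizing p K with
  | head h1 _ ih =>
    obtain ⟨m, hm, hr⟩ := ih (h1.affine hM) hs
    exact ⟨m + 1, by omega, .head h1 hr⟩
  | var k => cases hs
  | app h1 h2 ih1 ih2 =>
    rw [affine_app_iff] at hM
    cases hs with
    | beta P Q => exact h1.app_lam_contractum h2 hM.1
    | appFun hs =>
      obtain ⟨m, hm, hr⟩ := ih1 hM.1 hs
      exact ⟨_, by omega, .app hr h2⟩
    | appArg hs =>
      obtain ⟨m, hm, hr⟩ := ih2 hM.2 hs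
      exact ⟨_, by omega, .app h1 hr⟩
  | lam _ ih =>
    rw [affine_lam_iff] at hM
    cases hs with
    | lam hs =>
      obtain ⟨m, hm, hr⟩ := ih hM.1 hs
      exact ⟨m, hm, .lam hr⟩

theorem StdRed.trans_redSeq {n : ℕ} {M N K : Term} (h : StdRed n M N) (hM : M.Affine)
    (σ : RedSeq N K) : ∃ m ≤ n + σ.length, StdRed m M K := by
  induction σ generalizing n with
  | nil N => exact ⟨n, le_rfl, h⟩
  | cons p hs σ ih =>
    obtain ⟨m, hm, hr⟩ := h.trans_step hM hs
    obtain ⟨k, hk, hr'⟩ := ih hr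
    exact ⟨k, by simp only [RedSeq.length]; omega, hr'⟩

/-! ### Residuals in the immediate subterms -/

theorem Residual.of_nil {M : Term} {i : ℕ} {p r : Pos} (h : Residual M (i :: p) [] r) :
    r = [] := by
  generalize hq : ([] : Pos) = q at h
  cases h with
  | inBody => simp at hq
  | inArg => simp at hq
  | outside => rfl

theorem Residual.of_cons_ne {M : Term} {i j : ℕ} {p q r : Pos} (hij : i ≠ j)
    (h : Residual M (i :: p) (j :: q) r) : r = j :: q := by
  generalize hq : j :: q = q' at h
  cases h with
  | inBody => simp [hij.symm] at hq
  | inArg => simp [hij.symm] at hq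
  | outside => rfl

/-- Residuals of redexes inside an immediate subterm `M'` of `M` are computed in `M'`. -/
theorem Residual.of_cons {M M' : Term} {i : ℕ} (hM : ∀ p, M.subtermAt (i :: p) = M'.subtermAt p)
    {p q r : Pos} (h : Residual M (i :: p) (i :: q) r) :
    ∃ r', r = i :: r' ∧ Residual M' p q r' := by
  have hR : ∀ p, M.IsRedexAt (i :: p) → M'.IsRedexAt p := fun p ⟨P, Q, h⟩ => ⟨P, Q, hM p ▸ h⟩
  generalize hq : i :: q = q' at h
  cases h with
  | inBody h1 h2 =>
    simp only [List.cons_append, List.cons.injEq, true_and] at hq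
    subst hq
    exact ⟨_, rfl, .inBody (hM p ▸ h1) (hR _ h2)⟩
  | inArg h1 h2 h3 =>
    simp only [List.cons_append, List.cons.injEq, true_and] at hq
    subst hq
    exact ⟨_, rfl, .inArg (hM p ▸ h1) (hR _ h2) h3⟩
  | outside h1 h2 h3 =>
    subst hq
    exact ⟨q, rfl, .outside (hR _ h1) (hR _ h2) fun h => h3 (by simpa using h)⟩

namespace RedSeq

/-! ### Standard sequences in the immediate subterms -/

/-- The reduction sequence of an abstraction given by one of its body. -/
def lam : {M M' : Term} → RedSeq M M' → RedSeq (Term.lam M) (Term.lam M')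
  | _, _, nil _ => nil _
  | _, _, cons _ h σ => cons _ (.lam h) (lam σ)

/-- The reduction sequence of an application given by one of its argument. -/
def appArg (M : Term) : {N N' : Term} → RedSeq N N' → RedSeq (Term.app M N) (Term.app M N')
  | _, _, nil _ => nil _
  | _, _, cons _ h σ => cons _ (.appArg h) (appArg M σ)

/-- The reduction sequence of an application that first reduces the function part and then the
argument. -/
def app {N N' : Term} (τ : RedSeq N N') :
    {M M' : Term} → RedSeq M M' → RedSeq (Term.app M N) (Term.app M' N')
  | _, _, nil M => appArg M τ
  | _, _, cons _ h σ => cons _ (.appFun h) (app τ σ)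

theorem length_lam {M M' : Term} (σ : RedSeq M M') : σ.lam.length = σ.length := by
  induction σ with
  | nil => rfl
  | cons p h σ ih => simp [lam, length, ih]

theorem length_appArg (M : Term) {N N' : Term} (σ : RedSeq N N') :
    (σ.appArg M).length = σ.length := by
  induction σ with
  | nil => rfl
  | cons p h σ ih => simp [appArg, length, ih]

theorem length_app {M M' N N' : Term} (τ : RedSeq N N') (σ : RedSeq M M') :
    (app τ σ).length = σ.length + τ.length := by
  induction σ with
  | nil => simp [app, length, length_appArg]
  | cons p h σ ih => simp only [app, length, ih]; omega

theorem not_contractsResidual_lam_nil {M M' : Term} (σ : RedSeq M M') :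
    ¬ σ.lam.ContractsResidual [] := by
  induction σ with
  | nil => exact id
  | cons p h σ ih =>
    rintro (h0 | ⟨r, hr, hc⟩)
    · simp at h0
    · exact ih (hr.of_nil ▸ hc)

theorem not_contractsResidual_appArg_nil (M : Term) {N N' : Term} (σ : RedSeq N N') :
    ¬ (σ.appArg M).ContractsResidual [] := by
  induction σ with
  | nil => exact id
  | cons p h σ ih =>
    rintro (h0 | ⟨r, hr, hc⟩)
    · simp at h0
    · exact ih (hr.of_nil ▸ hc)

theorem not_contractsResidual_app_nil {M M' N N' : Term} (τ : RedSeq N N') (σ : RedSeq M M') :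
    ¬ (app τ σ).ContractsResidual [] := by
  induction σ with
  | nil M => exact not_contractsResidual_appArg_nil M τ
  | cons p h σ ih =>
    rintro (h0 | ⟨r, hr, hc⟩)
    · simp at h0
    · exact ih (hr.of_nil ▸ hc)

theorem not_contractsResidual_appArg_zero_cons (M : Term) {N N' : Term} (σ : RedSeq N N')
    (q : Pos) : ¬ (σ.appArg M).ContractsResidual (0 :: q) := by
  induction σ with
  | nil => exact id
  | cons p h σ ih =>
    rintro (h0 | ⟨r, hr, hc⟩)
    · simp at h0
    · exact ih (hr.of_cons_ne one_ne_zero ▸ hc)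

theorem ContractsResidual.of_lam {M M' : Term} {σ : RedSeq M M'} {q : Pos}
    (h : σ.lam.ContractsResidual (0 :: q)) : σ.ContractsResidual q := by
  induction σ generalizing q with
  | nil => exact h
  | cons p hs σ ih =>
    rcases h with h0 | ⟨r, hr, hc⟩
    · exact .inl (by simpa using h0)
    · obtain ⟨r', rfl, hr'⟩ := hr.of_cons fun _ => rfl
      exact .inr ⟨r', hr', ih hc⟩

theorem ContractsResidual.of_appArg {M N N' : Term} {σ : RedSeq N N'} {q : Pos}
    (h : (σ.appArg M).ContractsResidual (1 :: q)) : σ.ContractsResidual q := by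
  induction σ generalizing q with
  | nil => exact h
  | cons p hs σ ih =>
    rcases h with h0 | ⟨r, hr, hc⟩
    · exact .inl (by simpa using h0)
    · obtain ⟨r', rfl, hr'⟩ := hr.of_cons fun _ => rfl
      exact .inr ⟨r', hr', ih hc⟩

theorem ContractsResidual.of_app {M M' N N' : Term} {τ : RedSeq N N'} {σ : RedSeq M M'} {q : Pos}
    (h : (app τ σ).ContractsResidual (0 :: q)) : σ.ContractsResidual q := by
  induction σ generalizing q with
  | nil M => exact not_contractsResidual_appArg_zero_cons M τ q h
  | cons p hs σ ih =>
    rcases h with h0 | ⟨r, hr, hc⟩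
    · exact .inl (by simpa using h0)
    · obtain ⟨r', rfl, hr'⟩ := hr.of_cons fun _ => rfl
      exact .inr ⟨r', hr', ih hc⟩

theorem IsStandard.lam {M M' : Term} {σ : RedSeq M M'} (h : σ.IsStandard) :
    σ.lam.IsStandard := by
  induction σ with
  | nil => trivial
  | cons p hs σ ih =>
    refine ⟨?_, ih h.2⟩
    rintro (_ | ⟨_ | i, q⟩) r hq hl hr hc
    · exact not_contractsResidual_lam_nil σ (hr.of_nil ▸ hc)
    · obtain ⟨r', rfl, hr'⟩ := hr.of_cons fun _ => rfl
      exact h.1 q r' hq (by simpa [LeftOf, List.cons_lt_cons_iff] using hl) hr' hc.of_lam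
    · simp [LeftOf, List.cons_lt_cons_iff] at hl

theorem IsStandard.appArg (M : Term) {N N' : Term} {σ : RedSeq N N'} (h : σ.IsStandard) :
    (σ.appArg M).IsStandard := by
  induction σ with
  | nil => trivial
  | cons p hs σ ih =>
    refine ⟨?_, ih h.2⟩
    rintro (_ | ⟨_ | _ | i, q⟩) r hq hl hr hc
    · exact not_contractsResidual_appArg_nil M σ (hr.of_nil ▸ hc)
    · exact not_contractsResidual_appArg_zero_cons M σ q (hr.of_cons_ne one_ne_zero ▸ hc)
    · obtain ⟨r', rfl, hr'⟩ := hr.of_cons fun _ => rfl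
      exact h.1 q r' hq (by simpa [LeftOf, List.cons_lt_cons_iff] using hl) hr' hc.of_appArg
    · simp [LeftOf, List.cons_lt_cons_iff] at hl

theorem IsStandard.app {M M' N N' : Term} {τ : RedSeq N N'} {σ : RedSeq M M'}
    (hτ : τ.IsStandard) (h : σ.IsStandard) : (app τ σ).IsStandard := by
  induction σ with
  | nil M => exact hτ.appArg M
  | cons p hs σ ih =>
    refine ⟨?_, ih h.2⟩
    rintro (_ | ⟨_ | i, q⟩) r hq hl hr hc
    · exact not_contractsResidual_app_nil τ σ (hr.of_nil ▸ hc)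
    · obtain ⟨r', rfl, hr'⟩ := hr.of_cons fun _ => rfl
      exact h.1 q r' hq (by simpa [LeftOf, List.cons_lt_cons_iff] using hl) hr' hc.of_app
    · simp [LeftOf, List.cons_lt_cons_iff] at hl

end RedSeq

theorem StdRed.exists_isStandard {n : ℕ} {M N : Term} (h : StdRed n M N) :
    ∃ σ : RedSeq M N, σ.IsStandard ∧ σ.length = n := by
  induction h with
  | head h1 _ ih =>
    obtain ⟨p, hp, hl⟩ := h1.exists_step
    obtain ⟨σ, hσ, hn⟩ := ih
    exact ⟨.cons p hp σ, ⟨fun q _ hq hlt => absurd hlt (hl q hq), hσ⟩, by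
      simp only [RedSeq.length, hn]⟩
  | var k => exact ⟨.nil _, trivial, rfl⟩
  | app _ _ ih1 ih2 =>
    obtain ⟨σ, hσ, hm⟩ := ih1
    obtain ⟨τ, hτ, hn⟩ := ih2
    exact ⟨.app τ σ, hτ.app hσ, by rw [RedSeq.length_app, hm, hn]⟩
  | lam _ ih =>
    obtain ⟨σ, hσ, hn⟩ := ih
    exact ⟨σ.lam, hσ.lam, by rw [RedSeq.length_lam, hn]⟩

end Term

theorem mainTheorem2 (M N : Term) (hM : M.Affine) (σ : Term.RedSeq M N) :
    ∃ σs : Term.RedSeq M N, σs.IsStandard ∧ σs.length ≤ σ.length := by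
  obtain ⟨n, hn, h⟩ := (Term.StdRed.refl M).trans_redSeq hM σ
  obtain ⟨σs, hs, hl⟩ := h.exists_isStandard
  exact ⟨σs, hs, by omega⟩
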